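/- Let $q$ be a power of a prime, $r\ge 3$ and $\ell\ge 0$ integers, and let $\mathcal N_{q,r}$ be the norm-trace curve $$X^{\frac{q^r-1}{q-1}}=Y^{q^{r-1}}+Y^{q^{r-2}}+\cdots+Y$$ over $\mathbb F_{q^r}$, with function field $F=\mathbb F_{q^r}(x,y)$. A place of $F/\mathbb F_{q^r}$ is a discrete valuation ring of $F$ containing $\mathbb F_{q^r}$; $v_P$ denotes its normalized valuation. Then $\mathcal N_{q,r}$ has exactly one place at infinity $P_\infty$ (that is, a place that is a pole of $x$ or of $y$). It is $\mathbb F_{q^r}$-rational, and the set of all $\mathbb F_{q^r}$-rational places is finite. Let $\Omega$ be the set of the $\mathbb F_{q^r}$-rational places that are zeros of $x$, let $\Theta$ be the set of the remaining $\mathbb F_{q^r}$-rational places (so $P_\infty\in\Theta$), let $\Theta=\{P_1,\dots,P_n\}$ be an enumeration without repetition, and put $$D=P_1+\cdots+P_n,\qquad G=\sum_{P\in\Omega}\ell P,\qquad G'=\ell q^{r-1}P_\infty .$$ For a divisor $H$ let $\mathcal L(H)=\{f\in F^*:(f)+H\ge 0\}\cup\{0\}$. Let $$C=C_{\mathcal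 L}(D,G)=\{(f(P_1),\dots,f(P_n)) : f\in\mathcal L(G)\}\subseteq\mathbb F_{q^r}^n,$$ and, for an arbitrary choice of local parameters $t_i$ at $P_i$ ($1\le i\le n$), let $$C_{ext}(D,G')=\{((t_1^{n_1}f)(P_1),\dots,(t_n^{n_n}f)(P_n)) : f\in\mathcal L(G')\},$$ where $n_i$ is the coefficient of $P_i$ in $G'$. Then $C$ and $C_{ext}(D,G')$ are monomially equivalent: there is a matrix $M$ over $\mathbb F_{q^r}$, with exactly one nonzero entry in each row and in each column, such that $C_{ext}(D,G')=\{cM : c\in C\}$. More precisely, $G=G'+(x^\ell)$, that is, the coefficients at every place $P$ satisfy $G(P)=G'(P)+v_P(x^\ell)$; moreover $\mathcal L(G')=\{f x^\ell : f\in\mathcal L(G)\}$, and one can take for $M$ the diagonal matrix with the nonzero diagonal entries $(t_i^{n_i}x^\ell)(P_i)$, $1\le i\le n$; for each $f\in\mathcal L(G)$ it sends the codeword of $f$ in $C$ to the codeword of $f x^\ell$ in $C_{ext}(D,G')$. -/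

import Mathlib

open Polynomial

noncomputable section

/-! ## Places, divisors and Riemann-Roch spaces of a function field `F / k` -/

/-- A place of `F / k`: a discrete valuation ring of `F` that contains the constants `k`. -/
@[ext]
structure Place (k F : Type*) [Field k] [Field F] [Algebra k F] where
  ring : ValuationSubring F
  algebraMap_mem : ∀ a : k, algebraMap k F a ∈ ring
  isDVR : IsDiscreteValuationRing ring

namespace Place

variable {k F : Type*} [Field k] [Field F] [Algebra k F]

/-- The normalized discrete valuation at `P`, written multiplicatively: it takes the value
`exp (-m)` at a function that vanishes to order `m` at `P`, and the value `0` at `0`. -/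
def val (P : Place k F) : Valuation F (WithZero (Multiplicative ℤ)) :=
  haveI := P.isDVR
  (IsDiscreteValuationRing.maximalIdeal P.ring).valuation F

/-- The order of a nonzero function `f` at `P` (positive at zeros, negative at poles). -/
def ord (P : Place k F) (f : F) : ℤ := -WithZero.log (P.val f)

/-- `f` is regular at `P` and `f(P) = c`, that is, `f - c` vanishes at `P`. -/
def HasValue (P : Place k F) (f : F) (c : k) : Prop := P.val (f - algebraMap k F c) < 1

/-- `P` is `k`-rational: the residue field of `P` is `k`, so that every function that is regular
at `P` has a value in `k` there. -/
def IsRational (P : Place k F) : Prop := ∀ f ∈ P.ring, ∃ c : k, P.HasValue f c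

/-- `t` is a local parameter at `P`. -/
def IsLocalParameter (P : Place k F) (t : F) : Prop := P.val t = WithZero.exp (-1)

lemma val_le_one_iff (P : Place k F) (f : F) : P.val f ≤ 1 ↔ f ∈ P.ring := by
  have := P.isDVR
  constructor
  · intro h
    obtain ⟨a, ha⟩ := IsDiscreteValuationRing.exists_lift_of_le_one h
    rw [← ha]
    exact a.2
  · intro h
    exact IsDedekindDomain.HeightOneSpectrum.valuation_le_one _ (⟨f, h⟩ : P.ring)

lemma val_algebraMap_le_one (P : Place k F) (a : k) : P.val (algebraMap k F a) ≤ 1 :=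
  (P.val_le_one_iff _).2 (P.algebraMap_mem a)

/-- Each function that is regular at a rational place has exactly one value there. -/
lemma IsRational.existsUnique_hasValue {P : Place k F} (hP : P.IsRational) {f : F}
    (hf : f ∈ P.ring) : ∃! c : k, P.HasValue f c := by
  obtain ⟨c, hc⟩ := hP f hf
  refine ⟨c, hc, fun c' hc' => ?_⟩
  by_contra hne
  have h1 : P.val (algebraMap k F (c' - c)) < 1 := by
    have := P.val.map_sub_lt hc hc'
    rwa [sub_sub_sub_cancel_left, ← map_sub] at this
  have h2 := P.val_algebraMap_le_one (c' - c)⁻¹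
  have h3 : P.val (algebraMap k F (c' - c)) * P.val (algebraMap k F (c' - c)⁻¹) = 1 := by
    rw [← map_mul, ← map_mul, mul_inv_cancel₀ (sub_ne_zero.2 hne), map_one, map_one]
  exact absurd h3 (mul_lt_one_of_lt_of_le h1 h2).ne

end Place

/-- Divisors: finite formal `ℤ`-linear combinations of places. -/
abbrev Divisor (k F : Type*) [Field k] [Field F] [Algebra k F] := Place k F →₀ ℤ

section Codes

variable {k F : Type*} [Field k] [Field F] [Algebra k F]

/-- The Riemann-Roch space `𝓛(G) = {f | f = 0 or (f) + G ≥ 0}`; see `mem_riemannRoch_iff`. -/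
def riemannRoch (G : Divisor k F) : Submodule k F where
  carrier := {f | ∀ P : Place k F, P.val f ≤ WithZero.exp (G P)}
  zero_mem' := fun P => by simp
  add_mem' := fun hf hg P => P.val.map_add_le (hf P) (hg P)
  smul_mem' := fun a f hf P => by
    rw [Algebra.smul_def, map_mul]
    calc _ ≤ 1 * WithZero.exp (G P) := mul_le_mul' (P.val_algebraMap_le_one a) (hf P)
      _ = _ := one_mul _

lemma mem_riemannRoch_iff (G : Divisor k F) (f : F) :
    f ∈ riemannRoch G ↔ f = 0 ∨ ∀ P : Place k F, 0 ≤ P.ord f + G P := by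
  by_cases hf : f = 0
  · simp [hf]
  · simp only [hf, false_or]
    refine forall_congr' fun P => ?_
    have h0 : P.val f ≠ 0 := (Valuation.ne_zero_iff _).2 hf
    rw [← WithZero.log_le_iff_le_exp h0, Place.ord]
    constructor <;> intro h <;> linarith

/-- The functional AG code `C_𝓛(D, G)` with `D = P₁ + ⋯ + Pₙ`: the set of the words
`(f(P₁), …, f(Pₙ))` with `f ∈ 𝓛(G)`. It is used for distinct rational places `Pᵢ` outside the
support of `G`. -/
def functionalCode {n : ℕ} (P : Fin n → Place k F) (G : Divisor k F) :
    Submodule k (Fin n → k) where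
  carrier := {c | ∃ f ∈ riemannRoch G, ∀ i, (P i).HasValue f (c i)}
  zero_mem' := ⟨0, zero_mem _, fun i => by simp [Place.HasValue]⟩
  add_mem' := by
    rintro c d ⟨f, hf, hfc⟩ ⟨g, hg, hgd⟩
    refine ⟨f + g, add_mem hf hg, fun i => ?_⟩
    have := (P i).val.map_add_lt (hfc i) (hgd i)
    rw [Place.HasValue, Pi.add_apply, map_add]
    convert this using 2
    ring
  smul_mem' := by
    rintro a c ⟨f, hf, hfc⟩
    refine ⟨a • f, Submodule.smul_mem _ a hf, fun i => ?_⟩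
    rw [Place.HasValue, Pi.smul_apply, smul_eq_mul, map_mul, Algebra.smul_def, ← mul_sub, map_mul]
    exact (mul_le_of_le_one_left' ((P i).val_algebraMap_le_one a)).trans_lt (hfc i)

/-- The extended AG code `C_ext(D, G)` with `D = P₁ + ⋯ + Pₙ`, formed with the local parameters
`tᵢ` at `Pᵢ`: the set of the words `((t₁ ^ G(P₁) f)(P₁), …, (tₙ ^ G(Pₙ) f)(Pₙ))` with
`f ∈ 𝓛(G)`, where `G(P)` is the coefficient of `P` in `G`. -/
def extendedCode {n : ℕ} (P : Fin n → Place k F) (t : Fin n → F) (G : Divisor k F) :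
    Submodule k (Fin n → k) where
  carrier := {c | ∃ f ∈ riemannRoch G, ∀ i, (P i).HasValue (t i ^ (G (P i)) * f) (c i)}
  zero_mem' := ⟨0, zero_mem _, fun i => by simp [Place.HasValue]⟩
  add_mem' := by
    rintro c d ⟨f, hf, hfc⟩ ⟨g, hg, hgd⟩
    refine ⟨f + g, add_mem hf hg, fun i => ?_⟩
    have := (P i).val.map_add_lt (hfc i) (hgd i)
    rw [Place.HasValue, Pi.add_apply, map_add]
    convert this using 2
    ring
  smul_mem' := by
    rintro a c ⟨f, hf, hfc⟩
    refine ⟨a • f, Submodule.smul_mem _ a hf, fun i => ?_⟩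
    rw [Place.HasValue, Pi.smul_apply, smul_eq_mul, map_mul, Algebra.smul_def, mul_left_comm,
      ← mul_sub, map_mul]
    exact (mul_le_of_le_one_left' ((P i).val_algebraMap_le_one a)).trans_lt (hfc i)

/-- A monomial matrix: exactly one nonzero entry in each row and in each column. -/
def IsMonomialMatrix {n : ℕ} (M : Matrix (Fin n) (Fin n) k) : Prop :=
  (∀ i, ∃! j, M i j ≠ 0) ∧ ∀ j, ∃! i, M i j ≠ 0

/-- The code `{c M | c ∈ C}`; words are row vectors. -/
def Submodule.mulMatrix {n : ℕ} (C : Submodule k (Fin n → k)) (M : Matrix (Fin n) (Fin n) k) :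
    Submodule k (Fin n → k) := C.map M.vecMulLinear

/-- `C'` is obtained from `C` by a monomial matrix. -/
def MonomiallyEquivalent {n : ℕ} (C C' : Submodule k (Fin n → k)) : Prop :=
  ∃ M : Matrix (Fin n) (Fin n) k, IsMonomialMatrix M ∧ C' = C.mulMatrix M

end Codes

/-! ## The norm-trace curve `X ^ ((q ^ r - 1) / (q - 1)) = Y ^ (q ^ (r - 1)) + ⋯ + Y ^ q + Y` -/

namespace NormTrace

variable (k : Type*) [Field k] (q r : ℕ)

/-- The equation of the curve in `k[X][Y]`: `Y` is the outer variable, `X` the inner one. -/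
def equation : k[X][X] :=
  ∑ i ∈ Finset.range r, X ^ q ^ i - C (X ^ ((q ^ r - 1) / (q - 1)))

variable {k q r} in
/-- As a polynomial in `X` over `k[Y]` the equation is Eisenstein at `Y`. -/
lemma irreducible_equation (hq : 2 ≤ q) (hr : r ≠ 0) : Irreducible (equation k q r) := by
  set m := (q ^ r - 1) / (q - 1) with hm
  have hm0 : m ≠ 0 := by
    have h1 : q - 1 ≤ q ^ r - 1 := Nat.sub_le_sub_right (Nat.le_self_pow hr q) 1
    exact (Nat.div_pos h1 (by omega)).ne'
  set A : k[X] := ∑ i ∈ Finset.range r, X ^ q ^ i with hA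
  have hsw : Polynomial.Bivariate.swap (equation k q r) = -(X ^ m - C A) := by
    rw [equation, map_sub, map_sum, Polynomial.Bivariate.swap_C]
    simp only [map_pow, Polynomial.Bivariate.swap_Y, hA, map_sum, Polynomial.map_pow,
      Polynomial.map_X]
    ring
  have hA0 : A.coeff 0 = 0 := by
    rw [hA, Polynomial.finsetSum_coeff]
    refine Finset.sum_eq_zero fun i _ => ?_
    rw [Polynomial.coeff_X_pow, if_neg]
    exact (pow_pos (by omega : 0 < q) i).ne
  have hA1 : A.coeff 1 = 1 := by
    rw [hA, Polynomial.finsetSum_coeff, Finset.sum_eq_single 0]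
    · simp
    · intro i _ hi
      rw [Polynomial.coeff_X_pow, if_neg]
      exact (Nat.one_lt_pow hi (by omega)).ne
    · intro h
      exact absurd (Finset.mem_range.2 (Nat.pos_of_ne_zero hr)) h
  have key : Irreducible (X ^ m - C A : k[X][X]) := by
    have hmon : (X ^ m - C A : k[X][X]).Monic := Polynomial.monic_X_pow_sub_C A hm0
    have hdeg : (X ^ m - C A : k[X][X]).degree = m :=
      Polynomial.degree_X_pow_sub_C (Nat.pos_of_ne_zero hm0) A
    have hprime : (Ideal.span {(X : k[X])}).IsPrime :=
      (Ideal.span_singleton_prime Polynomial.X_ne_zero).2 Polynomial.prime_X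
    refine Polynomial.irreducible_of_eisenstein_criterion hprime ?_ ?_ ?_ ?_ hmon.isPrimitive
    · rw [hmon.leadingCoeff]
      exact fun h => hprime.ne_top ((Ideal.eq_top_iff_one _).2 h)
    · intro n hn
      rw [hdeg, Nat.cast_lt] at hn
      rw [Polynomial.coeff_sub, Polynomial.coeff_X_pow, if_neg hn.ne, zero_sub, neg_mem_iff,
        Polynomial.coeff_C]
      split_ifs
      · exact Ideal.mem_span_singleton.2 (Polynomial.X_dvd_iff.2 hA0)
      · exact zero_mem _
    · rw [hdeg]
      exact_mod_cast Nat.pos_of_ne_zero hm0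
    · rw [Polynomial.coeff_sub, Polynomial.coeff_X_pow, if_neg hm0.symm, zero_sub, neg_mem_iff,
        Polynomial.coeff_C_zero, Ideal.span_singleton_pow, Ideal.mem_span_singleton,
        Polynomial.X_pow_dvd_iff]
      intro h
      have := h 1 (by norm_num)
      rw [hA1] at this
      exact one_ne_zero this
  rw [← MulEquiv.irreducible_iff (Polynomial.Bivariate.swap (R := k)), hsw]
  exact (Associated.refl (X ^ m - C A : k[X][X])).neg_left.irreducible_iff.2 key

/-- The affine coordinate ring of the norm-trace curve. -/
abbrev CoordinateRing := AdjoinRoot (equation k q r)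

variable [hq : Fact (IsPrimePow q)] [hr : NeZero r]

instance : IsDomain (CoordinateRing k q r) :=
  AdjoinRoot.isDomain_of_prime (irreducible_equation hq.out.two_le hr.out).prime

/-- The field `k(x, y)` of `k`-rational functions on the norm-trace curve. -/
abbrev FunctionField := FractionRing (CoordinateRing k q r)

/-- The coordinate function `x`. -/
def x : FunctionField k q r := algebraMap (CoordinateRing k q r) _ (AdjoinRoot.of _ X)

/-- The coordinate function `y`. -/
def y : FunctionField k q r := algebraMap (CoordinateRing k q r) _ (AdjoinRoot.root _)

/-- The place `P` is centred at a point at infinity: one of the affine coordinate functions has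
a pole at `P`. -/
def IsInfinite (P : Place k (FunctionField k q r)) : Prop :=
  x k q r ∉ P.ring ∨ y k q r ∉ P.ring

/-- `Ω`: the `k`-rational places that are zeros of `x`. -/
def Ω : Set (Place k (FunctionField k q r)) := {P | P.IsRational ∧ P.HasValue (x k q r) 0}

/-- `Θ`: the `k`-rational places outside `Ω`. -/
def Θ : Set (Place k (FunctionField k q r)) := {P | P.IsRational} \ Ω k q r

/-- The multipoint divisor `G = ∑_{P ∈ Ω} ℓ P`. -/
def multipointDivisor (ℓ : ℕ) : Divisor k (FunctionField k q r) :=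
  ∑ᶠ P ∈ Ω k q r, Finsupp.single P (ℓ : ℤ)

end NormTrace

end

/-! Write m = (q^r - 1)/(q - 1) and d = q^(r-1). Everything rests on the divisor of x: it has a
simple zero at each place of Ω, a pole of order d at one place P∞, and no other zero or pole. Hence
(x^ℓ) = G - G', so multiplication by x^ℓ carries 𝓛(G) onto 𝓛(G'). Since Θ misses the support of G,
each t_i^(n_i) x^ℓ is a unit at P_i; its value there is the i-th diagonal entry
(`extendedCode_eq_mulMatrix`).

To find the places, `IsCommonUniformizer` describes a class of valuation rings in which every
nonzero f has the order of π^n, with n depending on f alone. Such a class has at most one member; a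
member is discrete, has π as local parameter and gives a rational place.

At infinity, m v(x) = d v(y) and qd = (q - 1)m + 1, so y^(q-1)/x^q has order 1. Modulo the equation
a function is a combination of monomials x^i y^j with j < d; these have distinct pole orders, so one
of them dominates (`exists_leading_monomial`). A pole of x exists because x is transcendental over
k.

At an affine point (a, c) the y-derivative of the equation is 1, because q = 0 in k. Thus y - c is
locally a multiple of x - a, and dividing by x - a repeatedly computes every order
(`exists_pow_mul_eq`).

Finally y^(q^r) - y = x^(mq) - x^m. Where x vanishes, so does the product of all y - b with b in k;
every zero of x is therefore centred at some (0, b), and is rational and simple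
(`exists_centredAt_zero`). -/

noncomputable section

/-! ### Classes of valuation rings with a common uniformizer -/

section LocalTheory

variable {k F : Type*} [Field k] [Field F] [Algebra k F]

/-- `π` is a uniformizer with residue field `k` for all the valuation rings that satisfy `Q`, and
the order of a function does not depend on the ring. -/
structure IsCommonUniformizer (k : Type*) {F : Type*} [Field k] [Field F] [Algebra k F]
    (Q : ValuationSubring F → Prop) (π : F) : Prop where
  algebraMap_mem : ∀ V, Q V → ∀ a : k, algebraMap k F a ∈ V
  ne_zero : π ≠ 0
  lt_one : ∀ V, Q V → V.valuation π < 1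
  exists_zpow : ∀ f : F, f ≠ 0 → ∃ n : ℤ, ∀ V, Q V → V.valuation f = V.valuation π ^ n ∧
    (n = 0 → ∃ c : k, V.valuation (f - algebraMap k F c) < 1)

lemma Place.isEquiv_val (P : Place k F) : P.val.IsEquiv P.ring.valuation := by
  rw [Valuation.isEquiv_iff_val_le_one]
  intro f
  rw [P.val_le_one_iff, ValuationSubring.valuation_le_one_iff]

lemma Place.val_lt_one_iff (P : Place k F) (f : F) : P.val f < 1 ↔ P.ring.valuation f < 1 :=
  Valuation.isEquiv_iff_val_lt_one.1 P.isEquiv_val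

lemma Place.val_eq_iff (P : Place k F) (f g : F) :
    P.val f = P.val g ↔ P.ring.valuation f = P.ring.valuation g :=
  P.isEquiv_val.eq_iff

lemma Place.exists_isLocalParameter (P : Place k F) : ∃ t, P.IsLocalParameter t := by
  have := P.isDVR
  exact (IsDiscreteValuationRing.maximalIdeal P.ring).valuation_exists_uniformizer F

namespace IsCommonUniformizer

variable {Q : ValuationSubring F → Prop} {π : F}

lemma zpow_le_one_iff (h : IsCommonUniformizer k Q π) {V : ValuationSubring F} (hV : Q V) (n : ℤ) :
    V.valuation π ^ n ≤ 1 ↔ 0 ≤ n :=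
  zpow_le_one_iff_right_of_lt_one₀ (zero_lt_iff.2 ((Valuation.ne_zero_iff _).2 h.ne_zero))
    (h.lt_one V hV)

lemma zpow_eq_one_iff (h : IsCommonUniformizer k Q π) {V : ValuationSubring F} (hV : Q V) (n : ℤ) :
    V.valuation π ^ n = 1 ↔ n = 0 :=
  zpow_eq_one_iff_right₀ zero_le (h.lt_one V hV).ne

/-- Membership of f is decided by the sign of an exponent that does not mention the ring. -/
lemma eq (h : IsCommonUniformizer k Q π) {V W : ValuationSubring F} (hV : Q V) (hW : Q W) :
    V = W := by
  refine ValuationSubring.ext _ _ fun f => ?_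
  by_cases hf : f = 0
  · simp [hf, V.zero_mem, W.zero_mem]
  obtain ⟨n, hn⟩ := h.exists_zpow f hf
  rw [← ValuationSubring.valuation_le_one_iff, ← ValuationSubring.valuation_le_one_iff,
    (hn V hV).1, (hn W hW).1, h.zpow_le_one_iff hV, h.zpow_le_one_iff hW]

lemma place_eq (h : IsCommonUniformizer k Q π) {P P' : Place k F} (hP : Q P.ring)
    (hP' : Q P'.ring) : P = P' :=
  Place.ext (h.eq hP hP')

/-- Every nonzero element is a unit times a power of π; a factorization π = ab has exponents with i
+ j = 1, so one factor is a unit. -/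
lemma isDiscreteValuationRing (h : IsCommonUniformizer k Q π) {V : ValuationSubring F} (hV : Q V) :
    IsDiscreteValuationRing V := by
  have hπ : π ∈ V := (V.valuation_le_one_iff π).1 (h.lt_one V hV).le
  have key : ∀ f : V, f ≠ 0 → ∃ n : ℕ, V.valuation (f : F) = V.valuation π ^ n := by
    intro f hf
    obtain ⟨n, hn⟩ := h.exists_zpow f (by simpa using hf)
    have h1 := (hn V hV).1
    have h2 := V.valuation_le_one f
    rw [h1, h.zpow_le_one_iff hV] at h2
    lift n to ℕ using h2
    exact ⟨n, by rw [h1, zpow_natCast]⟩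
  refine IsDiscreteValuationRing.ofHasUnitMulPowIrreducibleFactorization
    ⟨⟨π, hπ⟩, ⟨?_, ?_⟩, ?_⟩
  · rw [V.valuation_eq_one_iff]
    exact (h.lt_one V hV).ne
  · intro a b hab
    have hab' : π = a * b := congrArg Subtype.val hab
    have ha : a ≠ 0 := by rintro rfl; exact h.ne_zero (by simpa using hab')
    have hb : b ≠ 0 := by rintro rfl; exact h.ne_zero (by simpa using hab')
    obtain ⟨i, hi⟩ := key a ha
    obtain ⟨j, hj⟩ := key b hb
    have h1 : V.valuation π ^ ((i : ℤ) + j - 1) = 1 := by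
      rw [zpow_sub₀ ((Valuation.ne_zero_iff _).2 h.ne_zero), zpow_add₀
        ((Valuation.ne_zero_iff _).2 h.ne_zero), zpow_natCast, zpow_natCast, ← hi, ← hj,
        ← map_mul, ← hab', zpow_one, div_self ((Valuation.ne_zero_iff _).2 h.ne_zero)]
    rw [h.zpow_eq_one_iff hV] at h1
    rw [V.valuation_eq_one_iff, V.valuation_eq_one_iff, hi, hj]
    rcases (by omega : i = 0 ∨ j = 0) with rfl | rfl <;> simp
  · intro f hf
    obtain ⟨n, hn⟩ := key f hf
    refine ⟨n, ?_⟩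
    obtain ⟨a, ha⟩ := (V.valuation_eq_iff _ _).1 (hn.trans (map_pow _ _ _).symm)
    refine ⟨a, Subtype.ext ?_⟩
    rw [← ha]
    simp [mul_comm]

/-- The place of a valuation ring with a common uniformizer. -/
def place (h : IsCommonUniformizer k Q π) {V : ValuationSubring F} (hV : Q V) : Place k F :=
  ⟨V, h.algebraMap_mem V hV, h.isDiscreteValuationRing hV⟩

lemma isRational (h : IsCommonUniformizer k Q π) {P : Place k F} (hP : Q P.ring) :
    P.IsRational := by
  intro f hf
  rcases lt_or_eq_of_le ((P.val_le_one_iff f).2 hf) with h1 | h1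
  · exact ⟨0, by simpa [Place.HasValue] using h1⟩
  · have hf0 : f ≠ 0 := by rintro rfl; simp at h1
    obtain ⟨n, hn⟩ := h.exists_zpow f hf0
    obtain ⟨h2, h3⟩ := hn P.ring hP
    rw [← map_one P.val, P.val_eq_iff, map_one, h2, h.zpow_eq_one_iff hP] at h1
    obtain ⟨c, hc⟩ := h3 h1
    exact ⟨c, (P.val_lt_one_iff _).2 hc⟩

/-- A normalized parameter t has the order of some π^n, so the order of π divides 1; it is positive,
hence equal to 1. -/
lemma isLocalParameter (h : IsCommonUniformizer k Q π) {P : Place k F} (hP : Q P.ring) :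
    P.IsLocalParameter π := by
  obtain ⟨t, ht⟩ := P.exists_isLocalParameter
  have ht0 : t ≠ 0 := by
    rintro rfl
    rw [Place.IsLocalParameter, map_zero] at ht
    exact WithZero.exp_ne_zero ht.symm
  obtain ⟨n, hn⟩ := h.exists_zpow t ht0
  have h1 : P.val t = P.val π ^ n := by
    rw [← map_zpow₀, P.val_eq_iff, (hn _ hP).1, map_zpow₀]
  have hlt : P.val π < 1 := (P.val_lt_one_iff π).2 (h.lt_one _ hP)
  have hπ0 : P.val π ≠ 0 := (Valuation.ne_zero_iff _).2 h.ne_zero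
  have h2 : -1 = n * WithZero.log (P.val π) := by
    have := congrArg WithZero.log (ht.symm.trans h1)
    simpa [WithZero.log_zpow] using this
  have h3 : WithZero.log (P.val π) < 0 := by
    rw [← WithZero.log_one]
    exact (WithZero.log_lt_log hπ0 one_ne_zero).2 hlt
  have h4 : WithZero.log (P.val π) = -1 := by
    rcases Int.eq_one_or_neg_one_of_mul_eq_neg_one' h2.symm with h5 | h5 <;> omega
  rw [Place.IsLocalParameter, ← h4, WithZero.exp_log hπ0]

end IsCommonUniformizer

end LocalTheory

section Valuations

variable {k F : Type*} [Field k] [Field F] [Algebra k F]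

lemma ValuationSubring.valuation_algebraMap {V : ValuationSubring F}
    (hV : ∀ a : k, algebraMap k F a ∈ V) {a : k} (ha : a ≠ 0) :
    V.valuation (algebraMap k F a) = 1 := by
  refine le_antisymm ((V.valuation_le_one_iff _).2 (hV a)) ?_
  have h1 := (V.valuation_le_one_iff _).2 (hV a⁻¹)
  rw [map_inv₀, map_inv₀] at h1
  exact (inv_le_one₀ (zero_lt_iff.2 ((Valuation.ne_zero_iff _).2 (by simpa using ha)))).1 h1

end Valuations

/-! ### The place at infinity -/

namespace NormTrace

lemma sub_one_mul_div (q r : ℕ) : (q - 1) * ((q ^ r - 1) / (q - 1)) = q ^ r - 1 :=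
  Nat.mul_div_cancel' (by simpa using Nat.sub_dvd_pow_sub_pow q 1 r)

/-- This Bézout relation makes the pole orders of x and y at infinity coprime, and it dictates the
exponents in `infParameter`. -/
lemma mul_pow_pred_eq {q r : ℕ} (hq : 2 ≤ q) (hr : r ≠ 0) :
    q * q ^ (r - 1) = (q - 1) * ((q ^ r - 1) / (q - 1)) + 1 := by
  rw [sub_one_mul_div, mul_pow_sub_one hr, Nat.sub_add_cancel (Nat.one_le_pow _ _ (by omega))]

lemma div_ne_zero {q r : ℕ} (hq : 2 ≤ q) (hr : r ≠ 0) : (q ^ r - 1) / (q - 1) ≠ 0 := by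
  have h1 : q - 1 ≤ q ^ r - 1 := Nat.sub_le_sub_right (Nat.le_self_pow hr q) 1
  exact (Nat.div_pos h1 (by omega)).ne'

/-- The weights of the monomials `X ^ i * Y ^ j` with `j < d` are distinct. -/
lemma weight_injective {a d m i j i' j' : ℕ} {b : ℕ} (h : b * d = a * m + 1) (hj : j < d)
    (hj' : j' < d) (hw : i * d + j * m = i' * d + j' * m) : i = i' ∧ j = j' := by
  have hco : IsCoprime (d : ℤ) m := ⟨b, -a, by have : (b : ℤ) * d = a * m + 1 := by exact_mod_cast h
                                               linarith⟩
  have hw' : (i : ℤ) * d + j * m = i' * d + j' * m := by exact_mod_cast hw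
  have hdvd : (d : ℤ) ∣ (j - j') * m := ⟨i' - i, by linarith⟩
  have h1 : (d : ℤ) ∣ j - j' := hco.dvd_of_dvd_mul_right hdvd
  have h2 : (j : ℤ) - j' = 0 :=
    Int.eq_zero_of_abs_lt_dvd h1 (by rw [abs_lt]; constructor <;> omega)
  have h3 : j = j' := by omega
  subst h3
  exact ⟨Nat.eq_of_mul_eq_mul_right (by omega : 0 < d) (by omega), rfl⟩

variable {k : Type*} [Field k] {q r : ℕ}

lemma two_le (q : ℕ) [hq : Fact (IsPrimePow q)] : 2 ≤ q := hq.out.two_le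

lemma x_pow_eq : x k q r ^ ((q ^ r - 1) / (q - 1)) = ∑ i ∈ Finset.range r, y k q r ^ q ^ i := by
  have h : AdjoinRoot.mk (equation k q r) (equation k q r) = 0 := AdjoinRoot.mk_self
  conv_lhs at h => arg 2; rw [equation]
  rw [map_sub, sub_eq_zero, map_sum] at h
  have h' := congrArg (algebraMap _ (FunctionField k q r)) h
  simp only [map_pow, map_sum, AdjoinRoot.mk_X, AdjoinRoot.mk_C] at h'
  exact h'.symm

lemma natDegree_sum_X_pow (A : Type*) [CommRing A] [Nontrivial A] (hq : 2 ≤ q) (hr : r ≠ 0) :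
    (∑ i ∈ Finset.range r, (X : A[X]) ^ q ^ i).Monic ∧
    (∑ i ∈ Finset.range r, (X : A[X]) ^ q ^ i).natDegree = q ^ (r - 1) := by
  obtain ⟨s, rfl⟩ := Nat.exists_eq_succ_of_ne_zero hr
  have hdeg : (∑ i ∈ Finset.range s, (X : A[X]) ^ q ^ i).degree < (q ^ s : ℕ) := by
    refine (degree_sum_le _ _).trans_lt ((Finset.sup_lt_iff (WithBot.bot_lt_coe _)).2 ?_)
    intro i hi
    rw [degree_X_pow]
    exact_mod_cast Nat.pow_lt_pow_right (by omega) (Finset.mem_range.1 hi)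
  rw [Finset.sum_range_succ, add_comm]
  refine ⟨monic_X_pow_add hdeg, ?_⟩
  rw [natDegree_add_eq_left_of_degree_lt (by rwa [degree_X_pow]), natDegree_X_pow]
  simp

lemma algebraMap_mk (p : k[X][X]) :
    algebraMap _ (FunctionField k q r) (AdjoinRoot.mk (equation k q r) p) =
    ∑ s ∈ p.support.sigma fun j => (p.coeff j).support,
      algebraMap k _ ((p.coeff s.1).coeff s.2) * (x k q r ^ s.2 * y k q r ^ s.1) := by
  rw [Finset.sum_sigma]
  conv_lhs => rw [p.as_sum_support_C_mul_X_pow]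
  rw [map_sum, map_sum]
  refine Finset.sum_congr rfl fun j _ => ?_
  conv_lhs => rw [(p.coeff j).as_sum_support_C_mul_X_pow]
  simp only [map_sum, map_mul, map_pow, Finset.sum_mul, AdjoinRoot.mk_X, AdjoinRoot.mk_C]
  refine Finset.sum_congr rfl fun i _ => ?_
  rw [mul_assoc]
  congr 1

variable [hq : Fact (IsPrimePow q)] [hr : NeZero r]

lemma monic_equation : (equation k q r).Monic := by
  obtain ⟨h1, h2⟩ := natDegree_sum_X_pow k[X] (two_le q) hr.out
  refine h1.sub_of_left (degree_C_le.trans_lt ?_)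
  rw [degree_eq_natDegree h1.ne_zero, h2]
  exact_mod_cast Nat.pow_pos (by have := two_le q; omega)

lemma natDegree_equation : (equation k q r).natDegree = q ^ (r - 1) := by
  rw [equation, natDegree_sub_C, (natDegree_sum_X_pow k[X] (two_le q) hr.out).2]

variable (k q r) in
/-- The valuation rings over `k` in which `x` has a pole. -/
def PoleOfX (V : ValuationSubring (FunctionField k q r)) : Prop :=
  (∀ a : k, algebraMap k _ a ∈ V) ∧ x k q r ∉ V

variable (k q r) in
/-- A local parameter at infinity. -/
def infParameter : FunctionField k q r := y k q r ^ (q - 1) / x k q r ^ q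

lemma valuation_sum_y_pow {V : ValuationSubring (FunctionField k q r)}
    (hy : 1 < V.valuation (y k q r)) :
    V.valuation (∑ i ∈ Finset.range r, y k q r ^ q ^ i) = V.valuation (y k q r) ^ q ^ (r - 1) := by
  rw [V.valuation.map_sum_eq_of_lt (j := r - 1), map_pow]
  · simpa using Nat.pos_of_ne_zero hr.out
  · intro i hi
    rw [Finset.mem_sdiff, Finset.mem_range, Finset.mem_singleton] at hi
    rw [map_pow, map_pow]
    exact pow_lt_pow_right₀ hy (Nat.pow_lt_pow_right (two_le q) (by omega))

/-- At a pole of y the top power of y dominates the sum, so x has a pole; conversely x is integral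
over k[y]. -/
lemma x_mem_iff_y_mem (V : ValuationSubring (FunctionField k q r)) :
    x k q r ∈ V ↔ y k q r ∈ V := by
  constructor
  · intro hx
    by_contra hy
    rw [← V.valuation_le_one_iff, not_le] at hy
    have h1 := valuation_sum_y_pow hy
    rw [← x_pow_eq] at h1
    have h2 := (V.valuation_le_one_iff _).2 (pow_mem hx ((q ^ r - 1) / (q - 1)))
    rw [h1] at h2
    exact absurd h2 (not_le.2 (one_lt_pow₀ hy (pow_pos (by have := two_le q; omega) _).ne'))
  · intro hy
    have h1 : x k q r ^ ((q ^ r - 1) / (q - 1)) ∈ V := by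
      rw [x_pow_eq]
      exact sum_mem fun i _ => pow_mem hy _
    rw [← V.valuation_le_one_iff, map_pow] at h1
    rw [← V.valuation_le_one_iff]
    exact (pow_le_one_iff (div_ne_zero (two_le q) hr.out)).1 h1

namespace PoleOfX

variable {V : ValuationSubring (FunctionField k q r)}

lemma one_lt_x (h : PoleOfX k q r V) : 1 < V.valuation (x k q r) := by
  rw [← not_le, V.valuation_le_one_iff]
  exact h.2

lemma one_lt_y (h : PoleOfX k q r V) : 1 < V.valuation (y k q r) := by
  rw [← not_le, V.valuation_le_one_iff, ← x_mem_iff_y_mem]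
  exact h.2

lemma valuation_pow (h : PoleOfX k q r V) :
    V.valuation (x k q r) ^ ((q ^ r - 1) / (q - 1)) = V.valuation (y k q r) ^ q ^ (r - 1) := by
  rw [← valuation_sum_y_pow h.one_lt_y, ← x_pow_eq, map_pow]

lemma valuation_infParameter_ne_zero (h : PoleOfX k q r V) :
    V.valuation (infParameter k q r) ≠ 0 := by
  rw [infParameter, map_div₀, map_pow, map_pow]
  exact div_ne_zero_iff.2 ⟨pow_ne_zero _ (zero_lt_one.trans h.one_lt_y).ne',
    pow_ne_zero _ (zero_lt_one.trans h.one_lt_x).ne'⟩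

/-- Trading y^d for x^m turns the product into x to the power (q - 1)m + 1 - qd = 0. -/
lemma valuation_x (h : PoleOfX k q r V) :
    V.valuation (infParameter k q r) ^ q ^ (r - 1) * V.valuation (x k q r) = 1 := by
  have hx0 : V.valuation (x k q r) ≠ 0 := (zero_lt_one.trans h.one_lt_x).ne'
  rw [infParameter, map_div₀, map_pow, map_pow, div_pow, ← pow_mul, ← pow_mul,
    mul_comm (q - 1), pow_mul, ← h.valuation_pow, ← pow_mul, mul_pow_pred_eq (two_le q) hr.out,
    mul_comm _ (q - 1), pow_succ]
  field_simp

lemma valuation_y (h : PoleOfX k q r V) :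
    V.valuation (infParameter k q r) ^ ((q ^ r - 1) / (q - 1)) * V.valuation (y k q r) = 1 := by
  have hy0 : V.valuation (y k q r) ≠ 0 := (zero_lt_one.trans h.one_lt_y).ne'
  rw [infParameter, map_div₀, map_pow, map_pow, div_pow, ← pow_mul, ← pow_mul, mul_comm q,
    pow_mul (V.valuation (x k q r)), h.valuation_pow, ← pow_mul, mul_comm _ q,
    mul_pow_pred_eq (two_le q) hr.out, pow_succ]
  field_simp

lemma valuation_infParameter_lt_one (h : PoleOfX k q r V) :
    V.valuation (infParameter k q r) < 1 := by
  by_contra h1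
  rw [not_lt] at h1
  have h2 := one_lt_mul_of_le_of_lt (one_le_pow₀ (n := q ^ (r - 1)) h1) h.one_lt_x
  rw [h.valuation_x] at h2
  exact lt_irrefl _ h2

lemma valuation_monomial (h : PoleOfX k q r V) (i j : ℕ) :
    V.valuation (x k q r ^ i * y k q r ^ j) = V.valuation (infParameter k q r) ^
      (-((i * q ^ (r - 1) + j * ((q ^ r - 1) / (q - 1)) : ℕ) : ℤ)) := by
  rw [zpow_neg, zpow_natCast]
  refine eq_inv_of_mul_eq_one_left ?_
  rw [pow_add, mul_comm i, mul_comm j, pow_mul, pow_mul, map_mul, map_pow, map_pow,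
    mul_mul_mul_comm, mul_comm, ← mul_pow, ← mul_pow, mul_comm (V.valuation (x k q r)),
    mul_comm (V.valuation (y k q r)), h.valuation_x, h.valuation_y]
  simp

end PoleOfX

/-- Every nonzero function with poles only at infinity has a leading monomial there. -/
lemma exists_leading_monomial {f : CoordinateRing k q r} (hf : f ≠ 0) :
    ∃ c : k, c ≠ 0 ∧ ∃ i j : ℕ, j < q ^ (r - 1) ∧ ∀ V, PoleOfX k q r V →
      V.valuation (algebraMap _ _ f - algebraMap k _ c * (x k q r ^ i * y k q r ^ j)) <
        V.valuation (x k q r ^ i * y k q r ^ j) := by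
  classical
  obtain ⟨p, hp, rfl⟩ : ∃ p : k[X][X], p.natDegree < q ^ (r - 1) ∧ AdjoinRoot.mk _ p = f := by
    obtain ⟨p, rfl⟩ := AdjoinRoot.mk_surjective f
    -- The remainder has degree below q^(r-1) in y, the range in which the weights of monomials are
    -- distinct.
    refine ⟨p %ₘ equation k q r, ?_, ?_⟩
    · rw [← natDegree_equation (k := k)]
      refine natDegree_modByMonic_lt _ monic_equation fun h => ?_
      have := natDegree_equation (k := k) (q := q) (r := r)
      rw [h, natDegree_one] at this
      exact (pow_pos (by have := two_le q; omega) _).ne this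
    · exact AdjoinRoot.mk_eq_mk.2 ⟨-(p /ₘ equation k q r), by
        linear_combination modByMonic_add_div p (equation k q r)⟩
  set S := p.support.sigma fun j => (p.coeff j).support with hS
  have hmem : ∀ s ∈ S, s.1 < q ^ (r - 1) ∧ (p.coeff s.1).coeff s.2 ≠ 0 := by
    intro s hs
    rw [hS, Finset.mem_sigma] at hs
    exact ⟨(le_natDegree_of_mem_supp _ hs.1).trans_lt hp, mem_support_iff.1 hs.2⟩
  have hne : S.Nonempty := by
    rw [Finset.nonempty_iff_ne_empty]
    intro h
    have h1 := algebraMap_mk (q := q) (r := r) p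
    rw [← hS, h, Finset.sum_empty] at h1
    exact hf ((IsFractionRing.injective (CoordinateRing k q r) (FunctionField k q r))
      (by rw [h1, map_zero]))
  -- The monomial of largest weight has the highest pole; it is chosen before V, so it serves all V
  -- at once.
  obtain ⟨s, hs, hmax⟩ := S.exists_max_image
    (fun s => s.2 * q ^ (r - 1) + s.1 * ((q ^ r - 1) / (q - 1))) hne
  refine ⟨_, (hmem s hs).2, s.2, s.1, (hmem s hs).1, fun V hV => ?_⟩
  rw [algebraMap_mk, ← hS, ← Finset.sum_erase_eq_sub hs]
  have hγ := hV.valuation_infParameter_lt_one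
  have hγ0 := hV.valuation_infParameter_ne_zero
  refine V.valuation.map_sum_lt ?_ fun u hu => ?_
  · rw [hV.valuation_monomial]
    exact zpow_ne_zero _ hγ0
  · obtain ⟨hus, hu⟩ := Finset.mem_erase.1 hu
    rw [map_mul, ValuationSubring.valuation_algebraMap hV.1 (hmem u hu).2, one_mul,
      hV.valuation_monomial, hV.valuation_monomial]
    refine zpow_lt_zpow_right_of_lt_one₀ (zero_lt_iff.2 hγ0) hγ (neg_lt_neg ?_)
    refine Int.ofNat_lt.2 (lt_of_le_of_ne (hmax u hu) fun h => hus ?_)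
    obtain ⟨h1, h2⟩ := weight_injective (mul_pow_pred_eq (two_le q) hr.out)
      (hmem u hu).1 (hmem s hs).1 h
    exact Sigma.ext h2 (heq_of_eq h1)

lemma isCommonUniformizer_infParameter (h0 : infParameter k q r ≠ 0) :
    IsCommonUniformizer k (PoleOfX k q r) (infParameter k q r) where
  algebraMap_mem V hV := hV.1
  ne_zero := h0
  lt_one V hV := hV.valuation_infParameter_lt_one
  exists_zpow f hf := by
    obtain ⟨g, h, hh, rfl⟩ := IsFractionRing.div_surjective (A := CoordinateRing k q r) f
    have hh0 : h ≠ 0 := nonZeroDivisors.ne_zero hh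
    have hg0 : g ≠ 0 := by rintro rfl; simp at hf
    obtain ⟨c, hc, i, j, hj, hgc⟩ := exists_leading_monomial hg0
    obtain ⟨c', hc', i', j', hj', hhc⟩ := exists_leading_monomial hh0
    refine ⟨-((i * q ^ (r - 1) + j * ((q ^ r - 1) / (q - 1)) : ℕ) : ℤ) -
      -((i' * q ^ (r - 1) + j' * ((q ^ r - 1) / (q - 1)) : ℕ) : ℤ), fun V hV => ?_⟩
    have hv : ∀ (f : FunctionField k q r) (c : k) (M : FunctionField k q r), c ≠ 0 →
        V.valuation (f - algebraMap k _ c * M) < V.valuation M → V.valuation f = V.valuation M := by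
      intro f c M hc hlt
      have h1 : V.valuation (algebraMap k _ c * M) = V.valuation M := by
        rw [map_mul, ValuationSubring.valuation_algebraMap hV.1 hc, one_mul]
      rw [← h1] at hlt ⊢
      rw [← V.valuation.map_add_eq_of_lt_right hlt, sub_add_cancel]
    have hg := hv _ _ _ hc (hgc V hV)
    have hh := hv _ _ _ hc' (hhc V hV)
    have hγ0 := hV.valuation_infParameter_ne_zero
    refine ⟨by rw [zpow_sub₀ hγ0, map_div₀, hg, hh, hV.valuation_monomial,
      hV.valuation_monomial], fun hn => ⟨c / c', ?_⟩⟩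
    -- Exponent 0 means equal weights, so both leading monomials coincide and the quotient has
    -- residue c / c'.
    obtain ⟨rfl, rfl⟩ := weight_injective (mul_pow_pred_eq (two_le q) hr.out) hj hj'
      (by exact_mod_cast (neg_injective (sub_eq_zero.1 hn)))
    have hh0' : algebraMap _ (FunctionField k q r) h ≠ 0 := by simpa using hh0
    have hc0' : algebraMap k (FunctionField k q r) c' ≠ 0 := by simpa using hc'
    have hgc' := hgc V hV
    have hhc' := hhc V hV
    set M := x k q r ^ i * y k q r ^ j
    have key : algebraMap _ _ g / algebraMap _ _ h - algebraMap k (FunctionField k q r) (c / c') =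
        (algebraMap k _ c' * (algebraMap _ _ g - algebraMap k _ c * M) -
          algebraMap k _ c * (algebraMap _ _ h - algebraMap k _ c' * M)) /
          (algebraMap k _ c' * algebraMap _ _ h) := by
      rw [map_div₀]
      field_simp
      ring
    rw [key, map_div₀, map_mul, ValuationSubring.valuation_algebraMap hV.1 hc', one_mul, hh,
      div_lt_one₀ (by rw [← hh]; exact zero_lt_iff.2 ((Valuation.ne_zero_iff _).2 hh0'))]
    refine V.valuation.map_sub_lt ?_ ?_
    · rwa [map_mul, ValuationSubring.valuation_algebraMap hV.1 hc', one_mul]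
    · rwa [map_mul, ValuationSubring.valuation_algebraMap hV.1 hc, one_mul]

end NormTrace

/-! ### Residues and orders -/

section Valuations

variable {k F : Type*} [Field k] [Field F] [Algebra k F]

lemma ValuationSubring.valuation_mul_sub_mul_lt {V : ValuationSubring F} {f g a b : F}
    (hf : f ∈ V) (hb : b ∈ V) (hfa : V.valuation (f - a) < 1) (hgb : V.valuation (g - b) < 1) :
    V.valuation (f * g - a * b) < 1 := by
  have h : f * g - a * b = (g - b) * f + (f - a) * b := by ring
  rw [h]
  refine V.valuation.map_add_lt ?_ ?_ <;> rw [map_mul]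
  · exact mul_lt_one_of_lt_of_le hgb ((V.valuation_le_one_iff _).2 hf)
  · exact mul_lt_one_of_lt_of_le hfa ((V.valuation_le_one_iff _).2 hb)

lemma ValuationSubring.valuation_pow_sub_pow_lt {V : ValuationSubring F} {f a : F}
    (hf : f ∈ V) (ha : a ∈ V) (hfa : V.valuation (f - a) < 1) (n : ℕ) :
    V.valuation (f ^ n - a ^ n) < 1 := by
  induction n with
  | zero => simp
  | succ n ih =>
    rw [pow_succ, pow_succ]
    exact valuation_mul_sub_mul_lt (pow_mem hf n) ha ih hfa

lemma ValuationSubring.mem_of_valuation_sub_lt_one {V : ValuationSubring F} {f a : F}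
    (ha : a ∈ V) (hfa : V.valuation (f - a) < 1) : f ∈ V := by
  rw [← sub_add_cancel f a]
  exact V.add_mem _ _ ((V.valuation_le_one_iff _).1 hfa.le) ha

lemma ValuationSubring.valuation_eq_one_of_sub_lt_one {V : ValuationSubring F}
    (hV : ∀ a : k, algebraMap k F a ∈ V) {f : F} {a : k} (ha : a ≠ 0)
    (hfa : V.valuation (f - algebraMap k F a) < 1) : V.valuation f = 1 := by
  have h1 := valuation_algebraMap hV ha
  rw [← h1] at hfa ⊢
  rw [← V.valuation.map_add_eq_of_lt_right hfa, sub_add_cancel]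

namespace Place

lemma val_ne_zero (P : Place k F) {f : F} (hf : f ≠ 0) : P.val f ≠ 0 :=
  (Valuation.ne_zero_iff _).2 hf

lemma ord_mul (P : Place k F) {f g : F} (hf : f ≠ 0) (hg : g ≠ 0) :
    P.ord (f * g) = P.ord f + P.ord g := by
  rw [ord, ord, ord, map_mul, WithZero.log_mul (P.val_ne_zero hf) (P.val_ne_zero hg)]
  ring

lemma ord_pow (P : Place k F) (f : F) (n : ℕ) : P.ord (f ^ n) = n * P.ord f := by
  rw [ord, ord, map_pow, WithZero.log_pow]
  simp

lemma val_eq_exp (P : Place k F) {f : F} (hf : f ≠ 0) : P.val f = WithZero.exp (-P.ord f) := by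
  rw [ord, neg_neg, WithZero.exp_log (P.val_ne_zero hf)]

lemma ord_pos_iff (P : Place k F) {f : F} (hf : f ≠ 0) : 0 < P.ord f ↔ P.val f < 1 := by
  rw [P.val_eq_exp hf, ← WithZero.exp_zero, WithZero.exp_lt_exp]
  omega

lemma ord_eq_zero_iff (P : Place k F) {f : F} (hf : f ≠ 0) : P.ord f = 0 ↔ P.val f = 1 := by
  rw [P.val_eq_exp hf, ← WithZero.exp_zero, WithZero.exp_inj]
  omega

end Place

end Valuations

/-! ### Affine points and their uniformizers -/

namespace NormTrace

variable {k : Type*} [Field k] {q r : ℕ}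

lemma aeval_x (p : k[X]) :
    aeval (x k q r) p = algebraMap _ _ (AdjoinRoot.of (equation k q r) p) := by
  rw [x, aeval_algebraMap_apply]
  congr 1
  induction p using Polynomial.induction_on' with
  | add p q hp hq => rw [map_add, map_add, hp, hq]
  | monomial n a =>
    rw [aeval_monomial, ← C_mul_X_pow_eq_monomial, map_mul, map_pow]
    rfl

/-- Two divisions with remainder: p(X, Y) by Y - c, then p(X, c) by X - a; the constant is p(a, c).
-/
lemma exists_eq_const_add (a c : k) (f : CoordinateRing k q r) : ∃ (e : k)
    (s t : CoordinateRing k q r), algebraMap _ (FunctionField k q r) f = algebraMap k _ e +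
      (x k q r - algebraMap k _ a) * algebraMap _ _ s +
      (y k q r - algebraMap k _ c) * algebraMap _ _ t := by
  obtain ⟨p, rfl⟩ := AdjoinRoot.mk_surjective f
  obtain ⟨t, ht⟩ := X_sub_C_dvd_sub_C_eval (a := C c) (p := p)
  obtain ⟨s, hs⟩ := X_sub_C_dvd_sub_C_eval (a := a) (p := p.eval (C c))
  refine ⟨(p.eval (C c)).eval a, AdjoinRoot.mk _ (C s), AdjoinRoot.mk _ t, ?_⟩
  have h1 : p = C (C ((p.eval (C c)).eval a)) + C (X - C a) * C s + (X - C (C c)) * t := by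
    rw [← C_mul, ← hs, ← ht, C_sub]
    ring
  conv_lhs => rw [h1]
  simp only [map_add, map_mul, map_sub, AdjoinRoot.mk_X, AdjoinRoot.mk_C]
  rfl

variable [hq : Fact (IsPrimePow q)] [hr : NeZero r]

lemma transcendental_x : Transcendental k (x k q r) := by
  rw [transcendental_iff]
  intro p hp
  rw [aeval_x] at hp
  have h1 := (IsFractionRing.injective (CoordinateRing k q r) (FunctionField k q r))
    (hp.trans (map_zero _).symm)
  have hdeg : (equation k q r).degree ≠ 0 := by
    rw [degree_eq_natDegree monic_equation.ne_zero, natDegree_equation]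
    exact_mod_cast (pow_pos (by have := two_le q; omega) _).ne'
  exact (AdjoinRoot.of.injective_of_degree_ne_zero hdeg) (h1.trans (map_zero _).symm)

lemma x_sub_ne_zero (a : k) : x k q r - algebraMap k _ a ≠ 0 := by
  intro h
  exact transcendental_x (k := k) (q := q) (r := r)
    (by rw [sub_eq_zero.1 h]; exact isAlgebraic_algebraMap a)

lemma x_ne_zero : x k q r ≠ 0 := by
  simpa using x_sub_ne_zero (q := q) (r := r) (0 : k)

variable (k q r) in
-- The integral closure of k is the intersection of the valuation rings above it, and the
-- transcendental x lies outside.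
lemma exists_poleOfX : ∃ V, PoleOfX k q r V := by
  have hx : x k q r ∉ (integralClosure k (FunctionField k q r)).toSubring := fun h =>
    transcendental_x (IsIntegral.isAlgebraic h)
  obtain ⟨V, hV, hxV⟩ := Subring.exists_le_valuationSubring_of_isIntegrallyClosedIn hx
  exact ⟨V, fun a => hV ((integralClosure k (FunctionField k q r)).algebraMap_mem a), hxV⟩

variable (k q r) in
/-- The valuation rings over `k` that are centred at the affine point `(a, c)`. -/
def CentredAt (a c : k) (V : ValuationSubring (FunctionField k q r)) : Prop :=
  (∀ b : k, algebraMap k _ b ∈ V) ∧ V.valuation (x k q r - algebraMap k _ a) < 1 ∧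
    V.valuation (y k q r - algebraMap k _ c) < 1

lemma algebraMap_mem_of_x_mem {V : ValuationSubring (FunctionField k q r)}
    (hV : ∀ b : k, algebraMap k _ b ∈ V) (hx : x k q r ∈ V) (f : CoordinateRing k q r) :
    algebraMap _ (FunctionField k q r) f ∈ V := by
  obtain ⟨p, rfl⟩ := AdjoinRoot.mk_surjective f
  rw [algebraMap_mk]
  exact sum_mem fun s _ => mul_mem (hV _) (mul_mem (pow_mem hx _)
    (pow_mem ((x_mem_iff_y_mem V).1 hx) _))

namespace CentredAt

variable {a c : k} {V : ValuationSubring (FunctionField k q r)}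

lemma x_mem (h : CentredAt k q r a c V) : x k q r ∈ V :=
  V.mem_of_valuation_sub_lt_one (h.1 a) h.2.1

lemma y_mem (h : CentredAt k q r a c V) : y k q r ∈ V :=
  V.mem_of_valuation_sub_lt_one (h.1 c) h.2.2

lemma algebraMap_mem (h : CentredAt k q r a c V) (f : CoordinateRing k q r) :
    algebraMap _ (FunctionField k q r) f ∈ V :=
  algebraMap_mem_of_x_mem h.1 h.x_mem f

lemma valuation_sub_lt_one (h : CentredAt k q r a c V) (s t : CoordinateRing k q r) :
    V.valuation ((x k q r - algebraMap k _ a) * algebraMap _ _ s +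
      (y k q r - algebraMap k _ c) * algebraMap _ _ t) < 1 := by
  refine V.valuation.map_add_lt ?_ ?_ <;> rw [map_mul]
  · exact mul_lt_one_of_lt_of_le h.2.1 ((V.valuation_le_one_iff _).2 (h.algebraMap_mem s))
  · exact mul_lt_one_of_lt_of_le h.2.2 ((V.valuation_le_one_iff _).2 (h.algebraMap_mem t))

/-- The centre of a valuation ring lies on the curve. -/
lemma pow_eq (h : CentredAt k q r a c V) :
    a ^ ((q ^ r - 1) / (q - 1)) = ∑ i ∈ Finset.range r, c ^ q ^ i := by
  by_contra hne
  have h1 := V.valuation_pow_sub_pow_lt h.x_mem (h.1 a) h.2.1 ((q ^ r - 1) / (q - 1))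
  have h2 : V.valuation (∑ i ∈ Finset.range r, (y k q r ^ q ^ i - algebraMap k _ c ^ q ^ i)) < 1 :=
    V.valuation.map_sum_lt one_ne_zero fun i _ =>
      V.valuation_pow_sub_pow_lt h.y_mem (h.1 c) h.2.2 _
  have h3 := V.valuation.map_sub_lt h2 h1
  rw [Finset.sum_sub_distrib, ← x_pow_eq, sub_sub_sub_cancel_left] at h3
  have h4 := V.valuation_algebraMap h.1 (sub_ne_zero.2 hne)
  rw [map_sub, map_pow, map_sum] at h4
  simp only [map_pow] at h4
  exact h3.ne h4

end CentredAt

/-- The curve is smooth: near `(a, c)`, the function `y - c` is a multiple of `x - a`. -/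
lemma exists_mul_y_sub_eq (hq0 : (q : k) = 0) {a c : k}
    (hac : a ^ ((q ^ r - 1) / (q - 1)) = ∑ i ∈ Finset.range r, c ^ q ^ i) :
    ∃ u w : CoordinateRing k q r,
      (y k q r - algebraMap k _ c) * algebraMap _ _ u =
        (x k q r - algebraMap k _ a) * algebraMap _ _ w ∧
      ∀ V, CentredAt k q r a c V → V.valuation (algebraMap _ (FunctionField k q r) u) = 1 := by
  set X' : CoordinateRing k q r := AdjoinRoot.of _ X with hX'
  set Y' : CoordinateRing k q r := AdjoinRoot.root _ with hY'
  have hcurve : X' ^ ((q ^ r - 1) / (q - 1)) = ∑ i ∈ Finset.range r, Y' ^ q ^ i := by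
    apply IsFractionRing.injective (CoordinateRing k q r) (FunctionField k q r)
    rw [map_pow, map_sum]
    simp only [map_pow]
    exact x_pow_eq
  have hq0' : (q : CoordinateRing k q r) = 0 := by
    rw [← map_natCast (algebraMap k (CoordinateRing k q r)), hq0, map_zero]
  set A : (CoordinateRing k q r)[X] := ∑ i ∈ Finset.range r, X ^ q ^ i with hA
  have hA' : derivative A = 1 := by
    rw [hA, derivative_sum, Finset.sum_eq_single 0]
    · simp
    · intro i _ hi
      rw [derivative_X_pow, Nat.cast_pow, hq0', zero_pow hi]
      simp
    · intro h
      exact absurd (Finset.mem_range.2 (Nat.pos_of_ne_zero hr.out)) h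
  have hev : ∀ z, A.eval z = ∑ i ∈ Finset.range r, z ^ q ^ i := fun z => by
    simp [hA, eval_finsetSum]
  -- As A' = 1, the expansion at c is A(y) = A(c) + (y - c) + e (y - c)^2, so u = 1 + e (y - c) is a
  -- unit at (a, c).
  obtain ⟨e, he⟩ := A.binomExpansion (algebraMap k _ c) (Y' - algebraMap k _ c)
  obtain ⟨w, hw⟩ := sub_dvd_pow_sub_pow X' (algebraMap k _ a) ((q ^ r - 1) / (q - 1))
  rw [hA', eval_one, add_sub_cancel, hev, hev, ← hcurve] at he
  have hac' := congrArg (algebraMap k (CoordinateRing k q r)) hac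
  simp only [map_pow, map_sum] at hac'
  rw [he, ← hac'] at hw
  have hw' := congrArg (algebraMap _ (FunctionField k q r))
    (show (Y' - algebraMap k _ c) * (1 + e * (Y' - algebraMap k _ c)) =
      (X' - algebraMap k _ a) * w by rw [← hw]; ring)
  refine ⟨1 + e * (Y' - algebraMap k _ c), w, ?_, fun V hV => ?_⟩
  · rw [map_mul, map_mul, map_sub, map_sub] at hw'
    exact hw'
  · have h1 : algebraMap _ (FunctionField k q r) (1 + e * (Y' - algebraMap k _ c)) =
        1 + (y k q r - algebraMap k _ c) * algebraMap _ _ e := by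
      rw [map_add, map_one, map_mul, map_sub, mul_comm]
      rfl
    rw [h1]
    refine V.valuation.map_one_add_of_lt ?_
    rw [map_mul]
    exact mul_lt_one_of_lt_of_le hV.2.2 ((V.valuation_le_one_iff _).2 (hV.algebraMap_mem e))

/-- If f vanishes at (a, c), then u f = (x - a) g and g has smaller order at P. The place P serves
only to make this descent stop: n, g and e hold for every ring centred at (a, c). -/
lemma exists_pow_mul_eq {a c : k} {P : Place k (FunctionField k q r)}
    (hP : CentredAt k q r a c P.ring) {u w : CoordinateRing k q r}
    (huw : (y k q r - algebraMap k _ c) * algebraMap _ _ u =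
        (x k q r - algebraMap k _ a) * algebraMap _ _ w)
    (hu : P.ring.valuation (algebraMap _ (FunctionField k q r) u) = 1) (N : ℕ) :
    ∀ f : CoordinateRing k q r, f ≠ 0 → P.ord (algebraMap _ _ f) ≤ N →
      ∃ (n : ℕ) (g : CoordinateRing k q r) (e : k), e ≠ 0 ∧
        algebraMap _ (FunctionField k q r) u ^ n * algebraMap _ _ f =
          (x k q r - algebraMap k _ a) ^ n * algebraMap _ _ g ∧
        ∀ V, CentredAt k q r a c V →
          V.valuation (algebraMap _ (FunctionField k q r) g - algebraMap k _ e) < 1 := by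
  have hinj := IsFractionRing.injective (CoordinateRing k q r) (FunctionField k q r)
  have hx0 := x_sub_ne_zero (q := q) (r := r) a
  have hu0 : algebraMap _ (FunctionField k q r) u ≠ 0 := by
    intro h
    simp [h] at hu
  have hu1 : P.ord (algebraMap _ _ u) = 0 := by
    rw [P.ord_eq_zero_iff hu0, ← map_one P.val, P.val_eq_iff, hu, map_one]
  have hx1 : 0 < P.ord (x k q r - algebraMap k _ a) :=
    (P.ord_pos_iff hx0).2 ((P.val_lt_one_iff _).2 hP.2.1)
  induction N with
  | zero =>
    intro f hf hN
    obtain ⟨e, s, t, hest⟩ := exists_eq_const_add a c f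
    rw [add_assoc] at hest
    refine ⟨0, f, e, ?_, by simp, fun V hV => ?_⟩
    · rintro rfl
      -- A zero constant term would give f positive order at P, against the bound 0.
      have h1 := hP.valuation_sub_lt_one s t
      rw [map_zero, zero_add] at hest
      rw [← hest, ← P.val_lt_one_iff, ← P.ord_pos_iff (by simpa using hf)] at h1
      norm_num at hN
      omega
    · rw [hest, add_sub_cancel_left]
      exact hV.valuation_sub_lt_one s t
  | succ N ih =>
    intro f hf hN
    obtain ⟨e, s, t, hest⟩ := exists_eq_const_add a c f
    rw [add_assoc] at hest
    by_cases he : e = 0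
    · rw [he, map_zero, zero_add] at hest
      have h1 : algebraMap _ (FunctionField k q r) u * algebraMap _ _ f =
          (x k q r - algebraMap k _ a) * algebraMap _ _ (s * u + w * t) := by
        rw [hest, map_add, map_mul, map_mul]
        linear_combination algebraMap _ _ t * huw
      have hf0 : algebraMap _ (FunctionField k q r) f ≠ 0 := by simpa using hf
      have hg : s * u + w * t ≠ 0 := by
        intro h
        rw [h, map_zero, mul_zero] at h1
        exact mul_ne_zero hu0 hf0 h1
      have h2 := congrArg P.ord h1
      rw [P.ord_mul hu0 hf0, P.ord_mul hx0 ((map_ne_zero_iff _ hinj).2 hg), hu1] at h2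
      obtain ⟨n, g, e', he', hn, hV⟩ := ih _ hg (by push_cast at hN; omega)
      refine ⟨n + 1, g, e', he', ?_, hV⟩
      rw [pow_succ, mul_assoc, h1, pow_succ]
      linear_combination (x k q r - algebraMap k _ a) * hn
    · refine ⟨0, f, e, he, by simp, fun V hV => ?_⟩
      rw [hest, add_sub_cancel_left]
      exact hV.valuation_sub_lt_one s t

lemma isCommonUniformizer_x_sub (hq0 : (q : k) = 0) {a c : k} {P : Place k (FunctionField k q r)}
    (hP : CentredAt k q r a c P.ring) :
    IsCommonUniformizer k (CentredAt k q r a c) (x k q r - algebraMap k _ a) where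
  algebraMap_mem V hV := hV.1
  ne_zero := x_sub_ne_zero a
  lt_one V hV := hV.2.1
  exists_zpow f hf := by
    obtain ⟨u, w, huw, hu⟩ := exists_mul_y_sub_eq hq0 hP.pow_eq
    obtain ⟨f₁, f₂, hf₂, rfl⟩ := IsFractionRing.div_surjective (A := CoordinateRing k q r) f
    have hf₂0 : f₂ ≠ 0 := nonZeroDivisors.ne_zero hf₂
    have hf₁0 : f₁ ≠ 0 := by rintro rfl; simp at hf
    obtain ⟨n₁, g₁, e₁, he₁, hn₁, hV₁⟩ :=
      exists_pow_mul_eq hP huw (hu _ hP) _ f₁ hf₁0 (Int.self_le_toNat _)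
    obtain ⟨n₂, g₂, e₂, he₂, hn₂, hV₂⟩ :=
      exists_pow_mul_eq hP huw (hu _ hP) _ f₂ hf₂0 (Int.self_le_toNat _)
    have hx0 := x_sub_ne_zero (q := q) (r := r) a
    refine ⟨n₁ - n₂, fun V hV => ?_⟩
    have hv : ∀ (f g : FunctionField k q r) (n : ℕ) (e : k), e ≠ 0 →
        algebraMap _ (FunctionField k q r) u ^ n * f = (x k q r - algebraMap k _ a) ^ n * g →
        V.valuation (g - algebraMap k _ e) < 1 → V.valuation g = 1 ∧
          V.valuation f = V.valuation (x k q r - algebraMap k _ a) ^ n := by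
      intro f g n e he hn hg
      have hg1 := V.valuation_eq_one_of_sub_lt_one hV.1 he hg
      refine ⟨hg1, ?_⟩
      simpa [hu V hV, hg1] using congrArg V.valuation hn
    obtain ⟨h1, h1'⟩ := hv _ _ _ _ he₁ hn₁ (hV₁ V hV)
    obtain ⟨h2, h2'⟩ := hv _ _ _ _ he₂ hn₂ (hV₂ V hV)
    refine ⟨by rw [zpow_sub₀ ((Valuation.ne_zero_iff _).2 hx0), map_div₀, h1', h2', zpow_natCast,
      zpow_natCast], fun hn => ⟨e₁ / e₂, ?_⟩⟩
    obtain rfl : n₁ = n₂ := by omega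
    have hu0 : algebraMap _ (FunctionField k q r) u ≠ 0 := by
      intro h
      have := hu V hV
      simp [h] at this
    have hg₂ : algebraMap _ (FunctionField k q r) g₂ ≠ 0 := by
      intro h
      simp [h] at h2
    have he₂' : algebraMap k (FunctionField k q r) e₂ ≠ 0 := by simpa using he₂
    have hf₂' : algebraMap _ (FunctionField k q r) f₂ ≠ 0 := by simpa using hf₂0
    have hquot : algebraMap _ (FunctionField k q r) f₁ / algebraMap _ _ f₂ =
        algebraMap _ _ g₁ / algebraMap _ _ g₂ := by
      rw [← mul_div_mul_left _ _ (pow_ne_zero n₁ hu0), hn₁, hn₂,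
        mul_div_mul_left _ _ (pow_ne_zero n₁ hx0)]
    have key : algebraMap _ (FunctionField k q r) g₁ / algebraMap _ _ g₂ -
        algebraMap k _ (e₁ / e₂) =
        (algebraMap _ _ g₁ * algebraMap k _ e₂ - algebraMap k _ e₁ * algebraMap _ _ g₂) /
          (algebraMap _ _ g₂ * algebraMap k _ e₂) := by
      rw [map_div₀]
      field_simp
    rw [hquot, key, map_div₀, map_mul V.valuation (algebraMap _ _ g₂), h2,
      V.valuation_algebraMap hV.1 he₂, mul_one, div_one]
    refine V.valuation_mul_sub_mul_lt (hV.algebraMap_mem g₁) (hV.algebraMap_mem g₂) (hV₁ V hV) ?_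
    rw [Valuation.map_sub_swap]
    exact hV₂ V hV

end NormTrace

/-! ### Splitting of z^|k| - z over k -/

namespace FiniteField

lemma pow_card_sub_eq_prod (k : Type*) {F : Type*} [Field k] [Fintype k] [Field F] [Algebra k F]
    (z : F) : z ^ Fintype.card k - z = ∏ b : k, (z - algebraMap k F b) := by
  have h1 : (X ^ Fintype.card k - X : k[X]) = ∏ b : k, (X - C b) := by
    have hmon : (X ^ Fintype.card k - X : k[X]).Monic :=
      monic_X_pow_sub (by rw [degree_X]; exact_mod_cast Fintype.one_lt_card)
    have hroots := roots_X_pow_card_sub_X k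
    rw [← prod_multiset_X_sub_C_of_monic_of_roots_card_eq hmon, hroots]
    · rfl
    · rw [hroots, X_pow_card_sub_X_natDegree_eq k Fintype.one_lt_card]
      rfl
  simpa [map_prod] using congrArg (aeval z) h1

end FiniteField

/-! ### Codes under multiplication by a function -/

section Codes

variable {k F : Type*} [Field k] [Field F] [Algebra k F]

namespace Place

lemma HasValue.mul {P : Place k F} {f g : F} {a b : k} (hf : P.HasValue f a)
    (hg : P.HasValue g b) : P.HasValue (f * g) (a * b) := by
  rw [HasValue, P.val_lt_one_iff] at *
  rw [map_mul]
  exact P.ring.valuation_mul_sub_mul_lt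
    (P.ring.mem_of_valuation_sub_lt_one (P.algebraMap_mem a) hf) (P.algebraMap_mem b) hf hg

lemma HasValue.mem {P : Place k F} {f : F} {a : k} (hf : P.HasValue f a) : f ∈ P.ring := by
  rw [HasValue, P.val_lt_one_iff] at hf
  exact P.ring.mem_of_valuation_sub_lt_one (P.algebraMap_mem a) hf

lemma IsRational.hasValue_unique {P : Place k F} (hP : P.IsRational) {f : F} {a b : k}
    (ha : P.HasValue f a) (hb : P.HasValue f b) : a = b :=
  (hP.existsUnique_hasValue ha.mem).unique ha hb

lemma IsRational.exists_hasValue_ne_zero {P : Place k F} (hP : P.IsRational) {f : F}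
    (hf : P.val f = 1) : ∃ c : k, c ≠ 0 ∧ P.HasValue f c := by
  obtain ⟨c, hc⟩ := hP f ((P.val_le_one_iff f).1 hf.le)
  refine ⟨c, ?_, hc⟩
  rintro rfl
  rw [HasValue, map_zero, sub_zero, hf] at hc
  exact lt_irrefl _ hc

end Place

lemma riemannRoch_map_mulRight {G G' : Divisor k F} {h : F} (hh : h ≠ 0)
    (hG : ∀ P, G P = G' P + P.ord h) :
    (riemannRoch G).map (LinearMap.mulRight k h) = riemannRoch G' := by
  have key : ∀ f, f * h ∈ riemannRoch G' ↔ f ∈ riemannRoch G := by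
    intro f
    rw [mem_riemannRoch_iff, mem_riemannRoch_iff]
    by_cases hf : f = 0
    · simp [hf]
    · simp only [mul_eq_zero, hf, hh, or_self, false_or]
      refine forall_congr' fun P => ?_
      rw [P.ord_mul hf hh, hG P]
      constructor <;> intro h <;> linarith
  ext f
  rw [Submodule.mem_map]
  constructor
  · rintro ⟨g, hg, rfl⟩
    exact (key g).2 hg
  · intro hf
    have hfh : f / h * h = f := div_mul_cancel₀ f hh
    exact ⟨f / h, (key _).1 (by rwa [hfh]), hfh⟩

lemma isMonomialMatrix_diagonal {n : ℕ} {d : Fin n → k} (hd : ∀ i, d i ≠ 0) :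
    IsMonomialMatrix (Matrix.diagonal d) := by
  have h : ∀ i j, Matrix.diagonal d i j ≠ 0 ↔ i = j := by
    intro i j
    rw [Matrix.diagonal_apply]
    split_ifs with hij <;> simp [hij, hd]
  exact ⟨fun i => ⟨i, (h i i).2 rfl, fun j hj => ((h i j).1 hj).symm⟩,
    fun j => ⟨j, (h j j).2 rfl, fun i hi => (h i j).1 hi⟩⟩

lemma vecMulLinear_diagonal_apply {n : ℕ} (d c : Fin n → k) (i : Fin n) :
    (Matrix.diagonal d).vecMulLinear c i = c i * d i := by
  rw [Matrix.vecMulLinear_apply, Matrix.vecMul_diagonal]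

/-- If `G = G' + (h)` and `G` has no support in `D`, the values of `t ^ G'(P) * h` carry
`C_𝓛(D, G)` to `C_ext(D, G')`. -/
lemma extendedCode_eq_mulMatrix {n : ℕ} {P : Fin n → Place k F} {t : Fin n → F}
    {G G' : Divisor k F} {h : F} (hh : h ≠ 0) (hG : ∀ P, G P = G' P + P.ord h)
    (hP : ∀ i, (P i).IsRational) (hGP : ∀ i, G (P i) = 0)
    (ht : ∀ i, (P i).IsLocalParameter (t i)) :
    ∃ d : Fin n → k, (∀ i, (P i).HasValue (t i ^ G' (P i) * h) (d i)) ∧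
      IsMonomialMatrix (Matrix.diagonal d) ∧
      (∀ f ∈ riemannRoch G, ∀ c : Fin n → k, (∀ i, (P i).HasValue f (c i)) →
        ∀ i, (P i).HasValue (t i ^ G' (P i) * (f * h)) ((Matrix.diagonal d).vecMulLinear c i)) ∧
      extendedCode P t G' = (functionalCode P G).mulMatrix (Matrix.diagonal d) := by
  -- The order of this function is G'(P_i) + ord h = G(P_i) = 0.
  have hval : ∀ i, (P i).val (t i ^ G' (P i) * h) = 1 := by
    intro i
    have h1 := hG (P i)
    rw [hGP i] at h1
    rw [map_mul, map_zpow₀, ht i, (P i).val_eq_exp hh, ← WithZero.exp_zsmul, ← WithZero.exp_add,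
      ← WithZero.exp_zero]
    congr 1
    rw [smul_eq_mul]
    linarith
  choose d hd0 hd using fun i => (hP i).exists_hasValue_ne_zero (hval i)
  have hmul : ∀ (f : F) (c : Fin n → k), (∀ i, (P i).HasValue f (c i)) →
      ∀ i, (P i).HasValue (t i ^ G' (P i) * (f * h)) ((Matrix.diagonal d).vecMulLinear c i) := by
    intro f c hc i
    rw [vecMulLinear_diagonal_apply, mul_left_comm]
    exact (hc i).mul (hd i)
  refine ⟨d, hd, isMonomialMatrix_diagonal hd0, fun f _ => hmul f, ?_⟩
  ext c
  rw [Submodule.mulMatrix, Submodule.mem_map]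
  constructor
  · rintro ⟨f, hf, hc⟩
    rw [← riemannRoch_map_mulRight hh hG] at hf
    obtain ⟨g, hg, rfl⟩ := hf
    -- As G(P_i) = 0, elements of 𝓛(G) are regular at P_i and can be evaluated.
    have hg' : ∀ i, g ∈ (P i).ring := by
      intro i
      have h1 := hg (P i)
      rwa [hGP i, WithZero.exp_zero, (P i).val_le_one_iff] at h1
    choose b hb using fun i => hP i g (hg' i)
    exact ⟨b, ⟨g, hg, hb⟩, funext fun i => (hP i).hasValue_unique (hmul g b hb i) (hc i)⟩
  · rintro ⟨b, ⟨g, hg, hb⟩, rfl⟩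
    refine ⟨g * h, ?_, hmul g b hb⟩
    rw [← riemannRoch_map_mulRight hh hG]
    exact ⟨g, hg, rfl⟩

end Codes

/-! ### Rational places and the divisor of x -/

namespace NormTrace

lemma natCast_eq_zero_of_card {k : Type*} [Field k] [Finite k] {q r : ℕ}
    (hk : Nat.card k = q ^ r) : (q : k) = 0 := by
  have := Fintype.ofFinite k
  have h1 : ((q ^ r : ℕ) : k) = 0 := by
    rw [← hk, Nat.card_eq_fintype_card, Nat.cast_card_eq_zero]
  rw [Nat.cast_pow] at h1
  exact eq_zero_of_pow_eq_zero h1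

lemma sum_pow_of_isPrimePow {A : Type*} [Field A] {q : ℕ} (hq : IsPrimePow q)
    (hq0 : (q : A) = 0) {ι : Type*} (s : Finset ι) (f : ι → A) :
    (∑ i ∈ s, f i) ^ q = ∑ i ∈ s, f i ^ q := by
  obtain ⟨p, e, hp, -, rfl⟩ := (isPrimePow_nat_iff q).1 hq
  have : Fact p.Prime := ⟨hp⟩
  rw [Nat.cast_pow] at hq0
  have : CharP A p := (CharP.charP_iff_prime_eq_zero hp).2 (eq_zero_of_pow_eq_zero hq0)
  exact sum_pow_char_pow p e s f

variable {k : Type*} [Field k] {q r : ℕ} [hq : Fact (IsPrimePow q)] [hr : NeZero r]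

/-- Raising the trace sum to the power q shifts its terms by one, so the difference telescopes. -/
lemma y_pow_sub (hq0 : (q : k) = 0) : y k q r ^ q ^ r - y k q r =
    (x k q r ^ ((q ^ r - 1) / (q - 1))) ^ q - x k q r ^ ((q ^ r - 1) / (q - 1)) := by
  have hfrob : (∑ i ∈ Finset.range r, y k q r ^ q ^ i) ^ q =
      ∑ i ∈ Finset.range r, y k q r ^ q ^ (i + 1) := by
    have hq0' : (q : FunctionField k q r) = 0 := by
      rw [← map_natCast (algebraMap k (FunctionField k q r)), hq0, map_zero]
    rw [sum_pow_of_isPrimePow hq.out hq0']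
    simp only [← pow_mul, pow_succ]
  rw [x_pow_eq, hfrob, ← Finset.sum_sub_distrib,
    Finset.sum_range_sub fun i => y k q r ^ q ^ i]
  simp

/-- Every zero of `x` is centred at a rational point. -/
lemma exists_centredAt_zero [Finite k] (hk : Nat.card k = q ^ r)
    {V : ValuationSubring (FunctionField k q r)} (hV : ∀ a : k, algebraMap k _ a ∈ V)
    (hx : V.valuation (x k q r) < 1) : ∃ b, CentredAt k q r 0 b V := by
  have := Fintype.ofFinite k
  have hxV := (V.valuation_le_one_iff _).1 hx.le
  have hm : V.valuation (x k q r ^ ((q ^ r - 1) / (q - 1))) < 1 := by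
    rw [map_pow]
    exact pow_lt_one₀ zero_le hx (div_ne_zero (two_le q) hr.out)
  have h1 : V.valuation (∏ b : k, (y k q r - algebraMap k _ b)) < 1 := by
    rw [← FiniteField.pow_card_sub_eq_prod, ← Nat.card_eq_fintype_card, hk,
      y_pow_sub (natCast_eq_zero_of_card hk)]
    refine V.valuation.map_sub_lt ?_ hm
    rw [map_pow]
    exact pow_lt_one₀ zero_le hm (by have := two_le q; omega)
  -- Otherwise every y - b is a unit, and so is their product.
  by_contra! hno
  rw [map_prod, Finset.prod_eq_one fun b _ => ?_] at h1
  · exact lt_irrefl _ h1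
  · refine le_antisymm ((V.valuation_le_one_iff _).2
      (sub_mem ((x_mem_iff_y_mem V).1 hxV) (hV b))) (not_lt.1 fun hb => hno b ⟨hV, ?_, hb⟩)
    simpa using hx

lemma isInfinite_iff_poleOfX (P : Place k (FunctionField k q r)) :
    IsInfinite k q r P ↔ PoleOfX k q r P.ring := by
  rw [IsInfinite, ← x_mem_iff_y_mem, or_self]
  exact ⟨fun h => ⟨P.algebraMap_mem, h⟩, fun h => h.2⟩

lemma exists_centredAt_of_isRational {P : Place k (FunctionField k q r)} (hP : P.IsRational)
    (hx : x k q r ∈ P.ring) : ∃ a c, CentredAt k q r a c P.ring := by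
  obtain ⟨a, ha⟩ := hP _ hx
  obtain ⟨c, hc⟩ := hP _ ((x_mem_iff_y_mem _).1 hx)
  exact ⟨a, c, P.algebraMap_mem, (P.val_lt_one_iff _).1 ha, (P.val_lt_one_iff _).1 hc⟩

lemma infParameter_ne_zero : infParameter k q r ≠ 0 := by
  obtain ⟨V, hV⟩ := exists_poleOfX k q r
  exact (Valuation.ne_zero_iff _).1 hV.valuation_infParameter_ne_zero

/-- A rational place is a pole of x or is centred at one of the finitely many points of k × k, and
each case admits at most one place. -/
lemma finite_isRational [Finite k] (hq0 : (q : k) = 0) :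
    {P : Place k (FunctionField k q r) | P.IsRational}.Finite := by
  have h1 : {P : Place k (FunctionField k q r) | PoleOfX k q r P.ring}.Finite :=
    Set.Subsingleton.finite fun P hP P' hP' =>
      (isCommonUniformizer_infParameter infParameter_ne_zero).place_eq hP hP'
  have h2 : (⋃ a : k × k,
      {P : Place k (FunctionField k q r) | CentredAt k q r a.1 a.2 P.ring}).Finite :=
    Set.finite_iUnion fun a => Set.Subsingleton.finite fun P hP P' hP' =>
      (isCommonUniformizer_x_sub hq0 hP).place_eq hP hP'
  refine (h1.union h2).subset fun P hP => ?_
  by_cases hx : x k q r ∈ P.ring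
  · obtain ⟨a, c, h⟩ := exists_centredAt_of_isRational hP hx
    exact Or.inr (Set.mem_iUnion.2 ⟨(a, c), h⟩)
  · exact Or.inl ⟨P.algebraMap_mem, hx⟩

lemma ord_x_of_poleOfX {P : Place k (FunctionField k q r)} (hP : PoleOfX k q r P.ring) :
    P.ord (x k q r) = -(q : ℤ) ^ (r - 1) := by
  have h0 := infParameter_ne_zero (k := k) (q := q) (r := r)
  have ht := (isCommonUniformizer_infParameter h0).isLocalParameter hP
  have h1 : P.ord (infParameter k q r) = 1 := by
    rw [Place.ord, ht, WithZero.log_exp, neg_neg]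
  have h2 : P.ord (infParameter k q r ^ q ^ (r - 1) * x k q r) = 0 := by
    rw [P.ord_eq_zero_iff (mul_ne_zero (pow_ne_zero _ h0) x_ne_zero), ← map_one P.val,
      P.val_eq_iff, map_mul, map_pow, hP.valuation_x, map_one]
  rw [P.ord_mul (pow_ne_zero _ h0) x_ne_zero, P.ord_pow, h1] at h2
  push_cast at h2
  linarith

/-- Rationality comes for free: a zero of x is centred at some (0, b) with b in k. -/
lemma mem_Ω_iff [Finite k] (hk : Nat.card k = q ^ r) (P : Place k (FunctionField k q r)) :
    P ∈ Ω k q r ↔ P.val (x k q r) < 1 := by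
  constructor
  · rintro ⟨-, h⟩
    simpa [Place.HasValue] using h
  · intro h
    obtain ⟨b, hb⟩ := exists_centredAt_zero hk P.algebraMap_mem ((P.val_lt_one_iff _).1 h)
    exact ⟨(isCommonUniformizer_x_sub (natCast_eq_zero_of_card hk) hb).isRational hb,
      by simpa [Place.HasValue] using h⟩

lemma ord_x_of_mem_Ω [Finite k] (hk : Nat.card k = q ^ r) {P : Place k (FunctionField k q r)}
    (hP : P ∈ Ω k q r) : P.ord (x k q r) = 1 := by
  obtain ⟨b, hb⟩ := exists_centredAt_zero hk P.algebraMap_mem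
    ((P.val_lt_one_iff _).1 ((mem_Ω_iff hk P).1 hP))
  have h := (isCommonUniformizer_x_sub (natCast_eq_zero_of_card hk) hb).isLocalParameter hb
  rw [map_zero, sub_zero] at h
  rw [Place.ord, h, WithZero.log_exp, neg_neg]

lemma ord_x_eq_zero [Finite k] (hk : Nat.card k = q ^ r) {P : Place k (FunctionField k q r)}
    (hP : P ∉ Ω k q r) (hx : x k q r ∈ P.ring) : P.ord (x k q r) = 0 := by
  rw [P.ord_eq_zero_iff x_ne_zero]
  rw [mem_Ω_iff hk, not_lt] at hP
  exact le_antisymm ((P.val_le_one_iff _).2 hx) hP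

open Classical in
lemma multipointDivisor_apply (hΩ : (Ω k q r).Finite) (ℓ : ℕ)
    (P : Place k (FunctionField k q r)) :
    multipointDivisor k q r ℓ P = if P ∈ Ω k q r then (ℓ : ℤ) else 0 := by
  rw [multipointDivisor, finsum_mem_eq_finite_toFinset_sum _ hΩ, Finsupp.finsetSum_apply]
  simp [Finsupp.single_apply]

end NormTrace

end

/-! ### The monomial equivalence -/

theorem mainTheorem7 {k : Type*} [Field k] [Finite k] (q r ℓ : ℕ) [Fact (IsPrimePow q)]
    [NeZero r] (hr : 3 ≤ r) (hk : Nat.card k = q ^ r) :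
    -- the sums `G = ∑_{P ∈ Ω} ℓ P` and `D = ∑_{P ∈ Θ} P` are finite
    (NormTrace.Ω k q r).Finite ∧ (NormTrace.Θ k q r).Finite ∧
    -- there is a unique place at infinity, and it is rational and lies in `Θ`
    ∃ Pinf ∈ NormTrace.Θ k q r, (∀ P, NormTrace.IsInfinite k q r P ↔ P = Pinf) ∧
      ∀ G G' : Divisor k (NormTrace.FunctionField k q r),
        G = NormTrace.multipointDivisor k q r ℓ →
        G' = Finsupp.single Pinf ((ℓ : ℤ) * (q : ℤ) ^ (r - 1)) →
        -- `G = G' + (x ^ ℓ)`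
        (∀ P, G P = G' P + P.ord (NormTrace.x k q r ^ ℓ)) ∧
        -- multiplication by `x ^ ℓ` maps `𝓛(G)` onto `𝓛(G')`
        (riemannRoch G).map (LinearMap.mulRight k (NormTrace.x k q r ^ ℓ)) = riemannRoch G' ∧
        -- for every enumeration of `Θ` and all local parameters
        ∀ (n : ℕ) (P : Fin n → Place k (NormTrace.FunctionField k q r))
          (t : Fin n → NormTrace.FunctionField k q r),
          Function.Injective P → Set.range P = NormTrace.Θ k q r →
          (∀ i, (P i).IsLocalParameter (t i)) →
          MonomiallyEquivalent (functionalCode P G) (extendedCode P t G') ∧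
          -- the equivalence is multiplication by the values of `x ^ ℓ`
          ∃ d : Fin n → k,
            (∀ i, (P i).HasValue (t i ^ G' (P i) * NormTrace.x k q r ^ ℓ) (d i)) ∧
            IsMonomialMatrix (Matrix.diagonal d) ∧
            (∀ f ∈ riemannRoch G, ∀ c : Fin n → k, (∀ i, (P i).HasValue f (c i)) →
              ∀ i, (P i).HasValue (t i ^ G' (P i) * (f * NormTrace.x k q r ^ ℓ))
                ((Matrix.diagonal d).vecMulLinear c i)) ∧
            extendedCode P t G' = (functionalCode P G).mulMatrix (Matrix.diagonal d) := by
  classical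
  have hfin := NormTrace.finite_isRational (r := r) (NormTrace.natCast_eq_zero_of_card hk)
  have hΩ : (NormTrace.Ω k q r).Finite := hfin.subset fun P hP => hP.1
  obtain ⟨V, hV⟩ := NormTrace.exists_poleOfX k q r
  have hinf := NormTrace.isCommonUniformizer_infParameter
    (NormTrace.infParameter_ne_zero (k := k) (q := q) (r := r))
  set Pinf := hinf.place hV
  have hPinf : NormTrace.PoleOfX k q r Pinf.ring := hV
  have hPinfΩ : Pinf ∉ NormTrace.Ω k q r := fun h => hV.2 h.2.mem
  have hiff : ∀ P, NormTrace.PoleOfX k q r P.ring ↔ P = Pinf := fun P =>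
    ⟨fun h => hinf.place_eq h hPinf, fun h => h ▸ hPinf⟩
  refine ⟨hΩ, hfin.subset fun P hP => hP.1, Pinf, ⟨hinf.isRational hPinf, hPinfΩ⟩,
    fun P => (NormTrace.isInfinite_iff_poleOfX P).trans (hiff P), ?_⟩
  rintro G G' rfl rfl
  have hx : NormTrace.x k q r ^ ℓ ≠ 0 := pow_ne_zero _ NormTrace.x_ne_zero
  -- Three cases: at P∞ the pole of x^ℓ cancels G'; on Ω its order is ℓ; elsewhere all terms vanish.
  have hG : ∀ P, NormTrace.multipointDivisor k q r ℓ P =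
      Finsupp.single Pinf ((ℓ : ℤ) * (q : ℤ) ^ (r - 1)) P + P.ord (NormTrace.x k q r ^ ℓ) := by
    intro P
    rw [NormTrace.multipointDivisor_apply hΩ, P.ord_pow, Finsupp.single_apply]
    by_cases hP : P = Pinf
    · rw [hP, if_neg hPinfΩ, if_pos rfl, NormTrace.ord_x_of_poleOfX hPinf]
      ring
    · rw [if_neg (Ne.symm hP)]
      split_ifs with hPΩ
      · rw [NormTrace.ord_x_of_mem_Ω hk hPΩ]
        ring
      · rw [NormTrace.ord_x_eq_zero hk hPΩ (by
          by_contra h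
          exact hP ((hiff P).1 ⟨P.algebraMap_mem, h⟩))]
        ring
  refine ⟨hG, riemannRoch_map_mulRight hx hG, fun n P t _ hrange ht => ?_⟩
  have hPΘ : ∀ i, P i ∈ NormTrace.Θ k q r := fun i => hrange ▸ Set.mem_range_self i
  obtain ⟨d, hd, hmon, hmul, hext⟩ := extendedCode_eq_mulMatrix hx hG (fun i => (hPΘ i).1)
    (fun i => by rw [NormTrace.multipointDivisor_apply hΩ, if_neg (hPΘ i).2]) ht
  exact ⟨⟨_, hmon, hext⟩, d, hd, hmon, hmul, hext⟩
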